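/- Let $G$ be the infinity (king-move) graph: its vertex set is $\mathbb{Z}^2$, and $(x,y)$, $(x',y')$ are adjacent if and only if $\max\{|x-x'|,|y-y'|\}=1$. The tristance of three (not necessarily distinct) points of $\mathbb{Z}^2$ is the minimal number of edges of a tree in $G$ whose vertex set contains the three points (and possibly others). A set $A\subseteq\mathbb{Z}^2$ is a tristance anticode of diameter $d$ if $z_1,z_2,z_3$ have tristance at most $d$ for all $z_1,z_2,z_3\in A$ (repetitions allowed); it is optimal if it has the largest possible cardinality among the tristance anticodes of diameter $d$. For integers $a,b,c_0,c_1,c_2,c_3$, let $O(a,b,c_0,c_1,c_2,c_3)$ be the octagon of all $(x,y)\in\mathbb{Z}^2$ with $$0\le x\le a,\qquad 0\le y\le b,\qquad c_0\le x+y\le a+b-c_2,\qquad c_3-b\le x-y\le a-c_1 .$$ **Theorem.** Let $d\ge 0$ be an integer. Every optimal tristance anticode of diameter $d$ in $G$ is finite and has exactly $$\left\lceil \frac{4d^2+8d+2}{7}\right\rceil$$ points. Moreover, if $d\neq 1$, then a set $A\subseteq\mathbb{Z}^2$ is an optimal tristance anticode of diameter $d$ if and only if, up to translation and rotation by a multiple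 of $\pi/2$, $A=O(a,b,c_0,c_1,c_2,c_3)$, where the parameters and the cardinality are given by the following table: $$ \begin{array}{c|c|c|c|c} d \bmod 7 & a=b & c_0=c_2 & c_1=c_3 & |A|\\ \hline 0 & \frac{6d}{7} & \frac{2d}{7} & \frac{2d}{7} & \frac{4d^2+8d+7}{7}\\ 1 & \frac{6d+1}{7} & \frac{2d-2}{7} & \frac{2d+5}{7} & \frac{4d^2+8d+2}{7}\\ 2 & \frac{6d+2}{7} & \frac{2d+3}{7} & \frac{2d+3}{7} & \frac{4d^2+8d+3}{7}\\ 3 & \frac{6d-4}{7} & \frac{2d-6}{7} & \frac{2d-6}{7} & \frac{4d^2+8d+3}{7}\\ 4 & \frac{6d-3}{7} & \frac{2d-8}{7} & \frac{2d-1}{7} & \frac{4d^2+8d+2}{7}\\ 5 & \frac{6d-2}{7} & \frac{2d-3}{7} & \frac{2d-3}{7} & \frac{4d^2+8d+7}{7}\\ 6 & \frac{6d-1}{7} & \frac{2d-5}{7} & \frac{2d+2}{7} & \frac{4d^2+8d+4}{7} \end{array} $$ For $d=1$ the optimal tristance anticodes are, up to translation and rotation by a multiple of $\pi/2$, exactly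 the octagon of the table, $O(1,1,0,1,0,1)=\{(0,0),(1,1)\}$, and $O(1,0,0,0,0,0)=\{(0,0),(1,0)\}$; both have the cardinality given in the table. -/

import Mathlib

/-- The infinity (king-move) graph: vertex set `ℤ²`, with `z` and `w` adjacent if and only if
`max (|x - x'|, |y - y'|) = 1`. -/
def infinityGraph : SimpleGraph (ℤ × ℤ) where
  Adj z w := max |z.1 - w.1| |z.2 - w.2| = 1
  symm := ⟨fun z w h => by rw [abs_sub_comm w.1 z.1, abs_sub_comm w.2 z.2]; exact h⟩
  loopless := ⟨fun z h => by simp at h⟩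

/-- The tristance of three vertices of a graph: the number of edges of a minimal tree in the graph
whose vertex set contains the three vertices (and possibly further ones). The value is `⊤` if there
is no finite tree of this kind. -/
noncomputable def tristance {V : Type*} (G : SimpleGraph V) (z₁ z₂ z₃ : V) : ℕ∞ :=
  ⨅ (T : G.Subgraph) (_ : T.coe.IsTree ∧ z₁ ∈ T.verts ∧ z₂ ∈ T.verts ∧ z₃ ∈ T.verts),
    T.edgeSet.encard

/-- A tristance anticode of diameter `d`: all triples of its points (repetitions allowed) have
tristance at most `d`. -/
def IsTristanceAnticode {V : Type*} (G : SimpleGraph V) (d : ℕ) (A : Set V) : Prop :=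
  ∀ z₁ ∈ A, ∀ z₂ ∈ A, ∀ z₃ ∈ A, tristance G z₁ z₂ z₃ ≤ (d : ℕ∞)

/-- An optimal tristance anticode of diameter `d`: one of the largest possible cardinality. -/
def IsOptimalTristanceAnticode {V : Type*} (G : SimpleGraph V) (d : ℕ) (A : Set V) : Prop :=
  IsTristanceAnticode G d A ∧ ∀ B : Set V, IsTristanceAnticode G d B → B.encard ≤ A.encard

/-- The octagon `O(a, b, c₀, c₁, c₂, c₃)`. -/
def octagon (a b c₀ c₁ c₂ c₃ : ℤ) : Set (ℤ × ℤ) :=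
  {z | (0 ≤ z.1 ∧ z.1 ≤ a) ∧ (0 ≤ z.2 ∧ z.2 ≤ b) ∧
    (c₀ ≤ z.1 + z.2 ∧ z.1 + z.2 ≤ a + b - c₂) ∧
    (c₃ - b ≤ z.1 - z.2 ∧ z.1 - z.2 ≤ a - c₁)}

/-- Rotation of the plane by the angle `π / 2` about the origin. -/
def quarterTurn (z : ℤ × ℤ) : ℤ × ℤ := (-z.2, z.1)

/-- `A` arises from `B` by a rotation by a multiple of `π / 2` followed by a translation. -/
def EqUpToRotationTranslation (A B : Set (ℤ × ℤ)) : Prop :=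
  ∃ (k : ℕ) (v : ℤ × ℤ), A = (fun z => v + quarterTurn^[k] z) '' B

/-- The side length `a = b` of the octagon for diameter `d`, by the residue of `d` modulo `7`;
all the divisions by `7` here and in the next two definitions are exact. -/
def paramA (d : ℕ) : ℤ :=
  match d % 7 with
  | 0 => (6 * d) / 7
  | 1 => (6 * d + 1) / 7
  | 2 => (6 * d + 2) / 7
  | 3 => (6 * d - 4) / 7
  | 4 => (6 * d - 3) / 7
  | 5 => (6 * d - 2) / 7
  | _ => (6 * d - 1) / 7

/-- The parameter `c₀ = c₂`. -/
def paramC (d : ℕ) : ℤ :=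
  match d % 7 with
  | 0 => (2 * d) / 7
  | 1 => (2 * d - 2) / 7
  | 2 => (2 * d + 3) / 7
  | 3 => (2 * d - 6) / 7
  | 4 => (2 * d - 8) / 7
  | 5 => (2 * d - 3) / 7
  | _ => (2 * d - 5) / 7

/-- The parameter `c₁ = c₃`. -/
def paramC' (d : ℕ) : ℤ :=
  match d % 7 with
  | 0 => (2 * d) / 7
  | 1 => (2 * d + 5) / 7
  | 2 => (2 * d + 3) / 7
  | 3 => (2 * d - 6) / 7
  | 4 => (2 * d - 1) / 7
  | 5 => (2 * d - 3) / 7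
  | _ => (2 * d + 2) / 7

/-- The octagon with the parameters for diameter `d`. -/
def tableOctagon (d : ℕ) : Set (ℤ × ℤ) :=
  octagon (paramA d) (paramA d) (paramC d) (paramC' d) (paramC d) (paramC' d)

/-- The number of points of an optimal anticode of diameter `d`, by the residue of `d`
modulo `7`. -/
def tableSize (d : ℕ) : ℚ :=
  match d % 7 with
  | 0 => (4 * d ^ 2 + 8 * d + 7) / 7
  | 1 => (4 * d ^ 2 + 8 * d + 2) / 7
  | 2 => (4 * d ^ 2 + 8 * d + 3) / 7
  | 3 => (4 * d ^ 2 + 8 * d + 3) / 7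
  | 4 => (4 * d ^ 2 + 8 * d + 2) / 7
  | 5 => (4 * d ^ 2 + 8 * d + 7) / 7
  | _ => (4 * d ^ 2 + 8 * d + 4) / 7

open SimpleGraph

/-! Put `u = x + y` and `v = x - y`; the king distance is half the ℓ¹ distance in `(u, v)`. The set
`A` is an anticode of diameter `d` if and only if `|u p - u q| + |v p - v r| ≤ 2 * d` for all `p, q,
r ∈ A` (`isTristanceAnticode_infinityGraph_iff`): an edge changes `u` and `v` by at most 2 together,
and conversely walks to a median point form a small enough connected graph.

The extrema of `x`, `y`, `u`, `v` on an anticode bound an octagon, and the criterion gives four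
linear inequalities between its sides and cuts (`IsTristanceAnticode.exists_octagon`). These
inequalities alone make the whole octagon an anticode, so the problem is to maximize `(a + 1) * (b +
1) - ∑ cᵢ * (cᵢ + 1) / 2` under them.

The real optimum is near `a + 1 = b + 1 = 6 * (d + 1) / 7` and `cᵢ + 1 / 2 = 2 * (d + 1) / 7`. With
`d = 7 * n + r`, sides `6 * n + α`, `6 * n + β` and cuts `2 * n + gᵢ`, `octagon_param_bound` leaves
finitely many `(r, α, β)`, independently of `n`; integral tangent inequalities settle the `gᵢ`
(`octagon_param_opt`). An anticode of at least the claimed size then has as many points as its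
octagon and equals it. -/

/-! ### Lower bound for the tristance by variation along edges -/

/-- A weight on edges bounding the variation of `f` bounds the variation of `f` along a connected
subgraph. -/
theorem SimpleGraph.Subgraph.abs_sub_le_sum_edges {V : Type*} {G : SimpleGraph V} {T : G.Subgraph}
    (hT : T.Connected) (S : Finset (Sym2 V)) (hS : T.edgeSet = S) (f : V → ℤ) (w : Sym2 V → ℤ)
    (hw0 : ∀ e, 0 ≤ w e) (hw : ∀ x y, |f x - f y| ≤ w s(x, y)) {p q : V}
    (hp : p ∈ T.verts) (hq : q ∈ T.verts) : |f p - f q| ≤ ∑ e ∈ S, w e := by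
  classical
  obtain ⟨P, hP⟩ := (hT.preconnected ⟨p, hp⟩ ⟨q, hq⟩).exists_isPath
  have key : ∀ (a b : T.verts) (W : T.coe.Walk a b),
      |f a - f b| ≤ ((W.edges.map (Sym2.map Subtype.val)).map w).sum := by
    intro a b W
    induction W with
    | nil => simp
    | @cons a b c h W ih =>
      simp only [Walk.edges_cons, List.map_cons, List.sum_cons, Sym2.map_mk]
      have := abs_sub_le (f a) (f b) (f c)
      have := hw a b
      linarith
  refine (key _ _ P).trans ?_
  have hnd : (P.edges.map (Sym2.map Subtype.val)).Nodup :=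
    hP.isTrail.edges_nodup.map (Sym2.map.injective Subtype.val_injective)
  rw [← List.sum_toFinset _ hnd]
  refine Finset.sum_le_sum_of_subset_of_nonneg ?_ (fun e _ _ => hw0 e)
  intro e he
  simp only [List.mem_toFinset, List.mem_map] at he
  obtain ⟨e', he', rfl⟩ := he
  have h1 := P.edges_subset_edgeSet he'
  rw [← Finset.mem_coe, ← hS]
  induction e' with
  | _ x y => simpa using h1

/-- Within a tree, the `u`-variation from `p` to `q` and the `v`-variation from `p` to `r` are each
bounded by a sum over all edges, and an edge contributes at most 2 to the two sums together. -/
theorem infinityGraph_tristance_lower {d : ℕ} {p q r : ℤ × ℤ}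
    (h : tristance infinityGraph p q r ≤ d) :
    |(p.1 + p.2) - (q.1 + q.2)| + |(p.1 - p.2) - (r.1 - r.2)| ≤ 2 * d := by
  classical
  have h' : tristance infinityGraph p q r < (d : ℕ∞) + 1 :=
    lt_of_le_of_lt h (by exact_mod_cast Nat.lt_succ_self d)
  unfold tristance at h'
  simp only [iInf_lt_iff] at h'
  obtain ⟨T, ⟨hT, hp, hq, hr⟩, hlt⟩ := h'
  have hle : T.edgeSet.encard ≤ d := by
    rw [← ENat.lt_add_one_iff (by simp)]; exact hlt
  have hfin : T.edgeSet.Finite := Set.finite_of_encard_le_coe hle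
  have hc : T.Connected := ⟨hT.connected⟩
  have hcard : hfin.toFinset.card ≤ d := by
    rw [hfin.encard_eq_coe_toFinset_card] at hle; exact_mod_cast hle
  let wu : Sym2 (ℤ × ℤ) → ℤ := Sym2.lift ⟨fun x y => |(x.1 + x.2) - (y.1 + y.2)|,
    fun x y => abs_sub_comm _ _⟩
  let wv : Sym2 (ℤ × ℤ) → ℤ := Sym2.lift ⟨fun x y => |(x.1 - x.2) - (y.1 - y.2)|,
    fun x y => abs_sub_comm _ _⟩
  have h1 := Subgraph.abs_sub_le_sum_edges hc hfin.toFinset (by simp) (fun x => x.1 + x.2) wu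
    (fun e => by induction e with | _ x y => exact abs_nonneg _) (fun x y => le_rfl) hp hq
  have h2 := Subgraph.abs_sub_le_sum_edges hc hfin.toFinset (by simp) (fun x => x.1 - x.2) wv
    (fun e => by induction e with | _ x y => exact abs_nonneg _) (fun x y => le_rfl) hp hr
  have h3 : ∑ e ∈ hfin.toFinset, wu e + ∑ e ∈ hfin.toFinset, wv e ≤ 2 * d := by
    rw [← Finset.sum_add_distrib]
    have : ∀ e ∈ hfin.toFinset, wu e + wv e ≤ 2 := by
      intro e he
      rw [hfin.mem_toFinset] at he
      induction e with
      | _ x y =>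
        have hadj : infinityGraph.Adj x y := T.adj_sub he
        simp only [infinityGraph] at hadj
        simp only [wu, wv, Sym2.lift_mk]
        simp only [max_def, abs_eq_max_neg] at *
        split_ifs at * <;> omega
    refine (Finset.sum_le_card_nsmul _ _ 2 this).trans ?_
    simp only [nsmul_eq_mul]
    have : (hfin.toFinset.card : ℤ) ≤ d := by exact_mod_cast hcard
    linarith
  exact (add_le_add h1 h2).trans h3

/-! ### Upper bound for the tristance by walks to a median -/

theorem infinityGraph_exists_walk (n : ℕ) : ∀ p q : ℤ × ℤ, |p.1 - q.1| ≤ n → |p.2 - q.2| ≤ n →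
    ∃ W : infinityGraph.Walk p q, W.length ≤ n := by
  induction n with
  | zero =>
    intro p q h1 h2
    have : p = q := by
      ext
      · simp only [Nat.cast_zero, abs_nonpos_iff] at h1; linarith
      · simp only [Nat.cast_zero, abs_nonpos_iff] at h2; linarith
    subst this
    exact ⟨.nil, le_rfl⟩
  | succ n ih =>
    intro p q h1 h2
    by_cases hpq : p = q
    · subst hpq
      exact ⟨.nil, Nat.zero_le _⟩
    have hne : ¬ (p.1 = q.1 ∧ p.2 = q.2) := fun h => hpq (Prod.ext h.1 h.2)
    push_cast at h1 h2
    -- Each coordinate moves one step towards its target unless already there; since `p ≠ q`, at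
    -- least one moves, so the step is an edge.
    obtain ⟨x, hx, hx1, hx2⟩ : ∃ x : ℤ, |x - q.1| ≤ n ∧ |p.1 - x| ≤ 1 ∧
        (p.1 = q.1 ∨ |p.1 - x| = 1) := by
      simp only [abs_le, abs_eq zero_le_one] at *
      rcases lt_trichotomy p.1 q.1 with h | h | h
      · exact ⟨p.1 + 1, by omega⟩
      · exact ⟨p.1, by omega⟩
      · exact ⟨p.1 - 1, by omega⟩
    obtain ⟨y, hy, hy1, hy2⟩ : ∃ x : ℤ, |x - q.2| ≤ n ∧ |p.2 - x| ≤ 1 ∧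
        (p.2 = q.2 ∨ |p.2 - x| = 1) := by
      simp only [abs_le, abs_eq zero_le_one] at *
      rcases lt_trichotomy p.2 q.2 with h | h | h
      · exact ⟨p.2 + 1, by omega⟩
      · exact ⟨p.2, by omega⟩
      · exact ⟨p.2 - 1, by omega⟩
    obtain ⟨W, hW⟩ := ih (x, y) q hx hy
    have hadj : infinityGraph.Adj p (x, y) := by
      change max |p.1 - x| |p.2 - y| = 1
      apply le_antisymm (max_le hx1 hy1)
      rw [le_max_iff]
      omega
    exact ⟨.cons hadj W, by simpa using hW⟩

/-- A connected subgraph contains a spanning tree. -/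
theorem SimpleGraph.Subgraph.Connected.exists_isTree_le {V : Type*} {G : SimpleGraph V}
    {H : G.Subgraph} (hH : H.Connected) :
    ∃ T : G.Subgraph, T.verts = H.verts ∧ T ≤ H ∧ T.coe.IsTree := by
  obtain ⟨T, hle, hT⟩ := hH.coe.exists_isTree_le
  let T' : G.Subgraph :=
    { verts := H.verts
      Adj := fun x y => ∃ (hx : x ∈ H.verts) (hy : y ∈ H.verts), T.Adj ⟨x, hx⟩ ⟨y, hy⟩
      adj_sub := fun ⟨_, _, h⟩ => H.adj_sub (hle h)
      edge_vert := fun ⟨hx, _, _⟩ => hx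
      symm := ⟨fun _ _ ⟨hx, hy, h⟩ => ⟨hy, hx, h.symm⟩⟩ }
  refine ⟨T', rfl, ⟨le_rfl, fun _ _ ⟨_, _, h⟩ => hle h⟩, ?_⟩
  have : T'.coe = T := by
    ext x y
    exact ⟨fun ⟨_, _, h⟩ => h, fun h => ⟨x.2, y.2, h⟩⟩
  rw [this]
  exact hT

theorem SimpleGraph.Walk.encard_edgeSet_toSubgraph_le {V : Type*} {G : SimpleGraph V} {x y : V}
    (W : G.Walk x y) : W.toSubgraph.edgeSet.encard ≤ W.length := by
  classical
  have : W.toSubgraph.edgeSet = (W.edges.toFinset : Set (Sym2 V)) := by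
    ext e; simp
  rw [this, Set.encard_coe_eq_coe_finsetCard, ← W.length_edges]
  exact_mod_cast List.toFinset_card_le _

/-- The union of the three walks is connected through `m`, and a spanning tree of it has no more
edges than the walks together. -/
theorem tristance_le_of_walks {V : Type*} {G : SimpleGraph V} {p q r m : V} (P : G.Walk p m)
    (Q : G.Walk q m) (R : G.Walk r m) :
    tristance G p q r ≤ ((P.length + Q.length + R.length : ℕ) : ℕ∞) := by
  have hPQ : (P.toSubgraph ⊔ Q.toSubgraph).Connected :=
    Subgraph.connected_sup P.toSubgraph_connected.preconnected Q.toSubgraph_connected.preconnected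
      ⟨m, by simp⟩
  have hPQR : (P.toSubgraph ⊔ Q.toSubgraph ⊔ R.toSubgraph).Connected :=
    Subgraph.connected_sup hPQ.preconnected R.toSubgraph_connected.preconnected ⟨m, by simp⟩
  obtain ⟨T, hv, hle, hT⟩ := hPQR.exists_isTree_le
  have hmem : p ∈ T.verts ∧ q ∈ T.verts ∧ r ∈ T.verts := by simp [hv]
  refine (iInf₂_le T ⟨hT, hmem⟩).trans ?_
  refine (Set.encard_le_encard (Subgraph.edgeSet_mono hle)).trans ?_
  rw [Subgraph.edgeSet_sup, Subgraph.edgeSet_sup]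
  refine (Set.encard_union_le _ _).trans ?_
  push_cast
  gcongr
  · refine (Set.encard_union_le _ _).trans ?_
    gcongr <;> exact Walk.encard_edgeSet_toSubgraph_le _
  · exact Walk.encard_edgeSet_toSubgraph_le _

theorem abs_sub_add_abs_sub_of_le {x y z : ℤ} (h₁ : x ≤ y) (h₂ : y ≤ z) :
    |x - y| + |y - y| + |z - y| = z - x := by
  rw [sub_self, abs_zero, abs_of_nonpos (by linarith), abs_of_nonneg (by linarith)]
  ring

/-- A median of three integers can be moved by one at the cost of one. -/
theorem exists_abs_sub_sum_eq_add_one {x y z : ℤ} (h₁ : x ≤ y) (h₂ : y ≤ z) (h : x < z) :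
    ∃ w, (w = y + 1 ∨ w = y - 1) ∧ |x - w| + |y - w| + |z - w| = z - x + 1 := by
  rcases h₂.eq_or_lt with h' | h'
  · refine ⟨y - 1, .inr rfl, ?_⟩
    rw [abs_of_nonpos (by omega), abs_of_nonneg (by omega), abs_of_nonneg (by omega)]
    ring
  · refine ⟨y + 1, .inl rfl, ?_⟩
    rw [abs_of_nonpos (by omega), abs_of_nonpos (by omega), abs_of_nonneg (by omega)]
    ring

/-- Coordinatewise medians realize the sum of the two ranges, but `(a, b)` is a lattice point only
when the parities agree. If they disagree, the medians come from different points, which makes the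
sum of the ranges odd; the bound `2 * d` then leaves room to move `a` by one. -/
theorem exists_median_of_le {d u₁ u₂ u₃ v₁ v₂ v₃ : ℤ} (hu : u₁ ≤ u₂) (hu' : u₂ ≤ u₃)
    (e₁ : u₁ % 2 = v₁ % 2) (e₂ : u₂ % 2 = v₂ % 2) (e₃ : u₃ % 2 = v₃ % 2)
    (h₁ : u₃ - u₁ + |v₁ - v₂| ≤ 2 * d) (h₂ : u₃ - u₁ + |v₁ - v₃| ≤ 2 * d)
    (h₃ : u₃ - u₁ + |v₂ - v₃| ≤ 2 * d) :
    ∃ a b : ℤ, a % 2 = b % 2 ∧ |u₁ - a| + |u₂ - a| + |u₃ - a| +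
      (|v₁ - b| + |v₂ - b| + |v₃ - b|) ≤ 2 * d := by
  obtain ⟨b, V, hV, hle, hpar⟩ : ∃ b V : ℤ, |v₁ - b| + |v₂ - b| + |v₃ - b| = V ∧
      u₃ - u₁ + V ≤ 2 * d ∧ (u₂ % 2 = b % 2 ∨ (u₃ - u₁ + V) % 2 = 1 ∧ u₁ < u₃) := by
    rcases abs_cases (v₁ - v₂) with a | a <;> rcases abs_cases (v₁ - v₃) with b | b <;>
      rcases abs_cases (v₂ - v₃) with c | c
    all_goals first
      | exact ⟨v₁, |v₁ - v₂| + |v₁ - v₃|, by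
          rw [sub_self, abs_zero, zero_add, abs_sub_comm v₂, abs_sub_comm v₃], by omega, by omega⟩
      | exact ⟨v₂, |v₁ - v₂| + |v₂ - v₃|, by
          rw [sub_self, abs_zero, add_zero, abs_sub_comm v₃], by omega, by omega⟩
      | exact ⟨v₃, |v₁ - v₃| + |v₂ - v₃|, by rw [sub_self, abs_zero, add_zero], by omega, by omega⟩
  rcases hpar with hpar | ⟨hpar, hlt⟩
  · refine ⟨u₂, b, hpar, ?_⟩
    rw [abs_sub_add_abs_sub_of_le hu hu', hV]
    exact hle
  · by_cases hp : u₂ % 2 = b % 2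
    · refine ⟨u₂, b, hp, ?_⟩
      rw [abs_sub_add_abs_sub_of_le hu hu', hV]
      exact hle
    · obtain ⟨a, ha, hs⟩ := exists_abs_sub_sum_eq_add_one hu hu' hlt
      refine ⟨a, b, by omega, ?_⟩
      rw [hs, hV]
      omega

/-- A median point of three lattice points for the coordinates `x + y` and `x - y`. -/
theorem exists_median {d : ℤ} {p q r : ℤ × ℤ}
    (h : ∀ a ∈ ({p, q, r} : Set (ℤ × ℤ)), ∀ b ∈ ({p, q, r} : Set (ℤ × ℤ)),
      ∀ c ∈ ({p, q, r} : Set (ℤ × ℤ)),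
      |(a.1 + a.2) - (b.1 + b.2)| + |(a.1 - a.2) - (c.1 - c.2)| ≤ 2 * d) :
    ∃ m : ℤ × ℤ, max |p.1 - m.1| |p.2 - m.2| + max |q.1 - m.1| |q.2 - m.2|
      + max |r.1 - m.1| |r.2 - m.2| ≤ d := by
  wlog hpq : p.1 + p.2 ≤ q.1 + q.2 generalizing p q
  · obtain ⟨m, hm⟩ := this (p := q) (q := p) (by rwa [Set.insert_comm]) (by linarith)
    exact ⟨m, by linarith⟩
  wlog hqr : q.1 + q.2 ≤ r.1 + r.2 generalizing p q r
  · push Not at hqr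
    rcases le_total (p.1 + p.2) (r.1 + r.2) with hpr | hpr
    · obtain ⟨m, hm⟩ := this (p := p) (q := r) (r := q) (by rwa [Set.pair_comm]) hpr hqr.le
      exact ⟨m, by linarith⟩
    · obtain ⟨m, hm⟩ := this (p := r) (q := p) (r := q)
        (by rwa [Set.insert_comm, Set.pair_comm]) hpr hpq
      exact ⟨m, by linarith⟩
  have h1 := h p (by simp) r (by simp) q (by simp)
  have h2 := h p (by simp) r (by simp) r (by simp)
  have h3 := h r (by simp) p (by simp) q (by simp)
  rw [abs_of_nonpos (by linarith), neg_sub] at h1 h2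
  rw [abs_of_nonneg (by linarith), abs_sub_comm] at h3
  obtain ⟨p1, p2⟩ := p
  obtain ⟨q1, q2⟩ := q
  obtain ⟨r1, r2⟩ := r
  simp only at hpq hqr h1 h2 h3
  obtain ⟨a, b, hab, hm⟩ := exists_median_of_le (d := d) (u₁ := p1 + p2) (u₂ := q1 + q2)
    (u₃ := r1 + r2) (v₁ := p1 - p2) (v₂ := q1 - q2) (v₃ := r1 - r2) hpq hqr
    (by omega) (by omega) (by omega) h1 h2 h3
  · refine ⟨((a + b) / 2, (a - b) / 2), ?_⟩
    -- The king distance to the median is half the ℓ¹ distance in `(u, v)`.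
    have t (x y : ℤ) : 2 * max |x - (a + b) / 2| |y - (a - b) / 2| =
        |x + y - a| + |x - y - b| := by
      obtain ⟨k, hk⟩ : ∃ k, a = b + 2 * k := ⟨(a - b) / 2, by omega⟩
      have h1 : (a + b) / 2 = b + k := by omega
      have h2 : (a - b) / 2 = k := by omega
      rw [h1, h2]
      rcases abs_cases (x - (b + k)) with h | h <;> rcases abs_cases (y - k) with h' | h' <;>
        rcases abs_cases (x + y - a) with h'' | h'' <;>
        rcases abs_cases (x - y - b) with h''' | h''' <;>
        rcases max_cases |x - (b + k)| |y - k| with h4 | h4 <;> omega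
    have := t p1 p2
    have := t q1 q2
    have := t r1 r2
    simp only
    linarith

theorem infinityGraph_tristance_upper {d : ℕ} {p q r : ℤ × ℤ}
    (h : ∀ a ∈ ({p, q, r} : Set (ℤ × ℤ)), ∀ b ∈ ({p, q, r} : Set (ℤ × ℤ)),
      ∀ c ∈ ({p, q, r} : Set (ℤ × ℤ)),
      |(a.1 + a.2) - (b.1 + b.2)| + |(a.1 - a.2) - (c.1 - c.2)| ≤ 2 * d) :
    tristance infinityGraph p q r ≤ d := by
  obtain ⟨m, hm⟩ := exists_median h
  have w (z : ℤ × ℤ) : ∃ W : infinityGraph.Walk z m,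
      (W.length : ℤ) ≤ max |z.1 - m.1| |z.2 - m.2| := by
    have h0 : 0 ≤ max |z.1 - m.1| |z.2 - m.2| := le_max_of_le_left (abs_nonneg _)
    obtain ⟨W, hW⟩ := infinityGraph_exists_walk (max |z.1 - m.1| |z.2 - m.2|).toNat z m
      (by rw [Int.toNat_of_nonneg h0]; exact le_max_left _ _)
      (by rw [Int.toNat_of_nonneg h0]; exact le_max_right _ _)
    exact ⟨W, by omega⟩
  obtain ⟨P, hP⟩ := w p
  obtain ⟨Q, hQ⟩ := w q
  obtain ⟨R, hR⟩ := w r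
  refine (tristance_le_of_walks P Q R).trans ?_
  have : P.length + Q.length + R.length ≤ d := by zify; linarith
  exact_mod_cast this

/-- After this the graph plays no role: being an anticode is a family of linear inequalities. A
common point `p` suffices, since among three points the pairs realizing the two ranges can be chosen
to share a point. -/
theorem isTristanceAnticode_infinityGraph_iff {d : ℕ} {A : Set (ℤ × ℤ)} :
    IsTristanceAnticode infinityGraph d A ↔ ∀ p ∈ A, ∀ q ∈ A, ∀ r ∈ A,
      |(p.1 + p.2) - (q.1 + q.2)| + |(p.1 - p.2) - (r.1 - r.2)| ≤ 2 * d := by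
  refine ⟨fun h p hp q hq r hr => infinityGraph_tristance_lower (h p hp q hq r hr),
    fun h p hp q hq r hr => infinityGraph_tristance_upper fun a ha b hb c hc => ?_⟩
  have hs : ({p, q, r} : Set (ℤ × ℤ)) ⊆ A := by
    rintro x (rfl | rfl | rfl) <;> assumption
  exact h a (hs ha) b (hs hb) c (hs hc)

/-! ### Counting the points of an octagon -/

/-- The corner `x + y < c` of a box of side lengths at least `c` has `c * (c + 1) / 2` points. -/
theorem two_mul_card_corner {a b : ℤ} (c : ℕ) (ha : c ≤ a) (hb : c ≤ b) :
    2 * (((Finset.Icc 0 a ×ˢ Finset.Icc 0 b).filter (fun z => z.1 + z.2 < (c : ℤ))).card : ℤ) =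
      c * (c + 1) := by
  have h : ((Finset.Icc 0 a ×ˢ Finset.Icc 0 b).filter (fun z => z.1 + z.2 < (c : ℤ))).card =
      ((Finset.range c).sigma (fun i => Finset.range (i + 1))).card := by
    refine Finset.card_nbij' (fun z => ⟨(z.1 + z.2).toNat, z.1.toNat⟩)
      (fun w => ((w.2 : ℤ), (w.1 : ℤ) - w.2)) ?_ ?_ ?_ ?_
    · rintro ⟨x, y⟩ hz
      simp at hz ⊢
      omega
    · rintro ⟨i, j⟩ hz
      simp at hz ⊢
      omega
    · rintro ⟨x, y⟩ hz
      simp at hz ⊢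
      omega
    · rintro ⟨i, j⟩ hz
      simp at hz ⊢
  rw [h, Finset.card_sigma]
  simp only [Finset.card_range]
  clear h ha hb
  induction c with
  | zero => simp
  | succ n ih =>
    rw [Finset.sum_range_succ]
    push_cast at ih ⊢
    linarith

theorem octagon_eq_coe_filter (a b c₀ c₁ c₂ c₃ : ℤ) :
    octagon a b c₀ c₁ c₂ c₃ = ((Finset.Icc 0 a ×ˢ Finset.Icc 0 b).filter (fun z =>
      (c₀ ≤ z.1 + z.2 ∧ z.1 + z.2 ≤ a + b - c₂) ∧
      (c₃ - b ≤ z.1 - z.2 ∧ z.1 - z.2 ≤ a - c₁)) : Finset (ℤ × ℤ)) := by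
  ext z
  simp [octagon, and_assoc]

theorem octagon_finite (a b c₀ c₁ c₂ c₃ : ℤ) : (octagon a b c₀ c₁ c₂ c₃).Finite := by
  rw [octagon_eq_coe_filter]
  exact Finset.finite_toSet _

/-- The number of points of an octagon whose cut corners do not overlap. -/
theorem two_mul_ncard_octagon {a b c₀ c₁ c₂ c₃ : ℤ} (h₀ : 0 ≤ c₀) (h₁ : 0 ≤ c₁) (h₂ : 0 ≤ c₂)
    (h₃ : 0 ≤ c₃) (h₀₁ : c₀ + c₁ ≤ a) (h₁₂ : c₁ + c₂ ≤ b) (h₂₃ : c₂ + c₃ ≤ a)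
    (h₃₀ : c₀ + c₃ ≤ b) :
    2 * ((octagon a b c₀ c₁ c₂ c₃).ncard : ℤ) = 2 * ((a + 1) * (b + 1)) -
      (c₀ * (c₀ + 1) + c₁ * (c₁ + 1) + c₂ * (c₂ + 1) + c₃ * (c₃ + 1)) := by
  rw [octagon_eq_coe_filter, Set.ncard_coe_finset]
  have hbox : ((Finset.Icc 0 a ×ˢ Finset.Icc 0 b).card : ℤ) = (a + 1) * (b + 1) := by
    rw [Finset.card_product, Int.card_Icc, Int.card_Icc]
    push_cast
    rw [Int.toNat_of_nonneg (by linarith), Int.toNat_of_nonneg (by linarith)]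
    ring
  -- Every corner is carried to the one at the origin by an involution `f` of the box.
  have corner {c : ℤ} (h : 0 ≤ c) (ha : c ≤ a) (hb : c ≤ b) (f : ℤ × ℤ → ℤ × ℤ)
      (hf : ∀ z ∈ Finset.Icc 0 a ×ˢ Finset.Icc 0 b, f z ∈ Finset.Icc 0 a ×ˢ Finset.Icc 0 b ∧
        f (f z) = z) :
      2 * (((Finset.Icc 0 a ×ˢ Finset.Icc 0 b).filter
        (fun z => (f z).1 + (f z).2 < c)).card : ℤ) = c * (c + 1) := by
    lift c to ℕ using h
    rw [← two_mul_card_corner c ha hb]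
    congr 2
    refine Finset.card_nbij' f f ?_ ?_ ?_ ?_
    · intro z hz
      rw [Finset.mem_coe, Finset.mem_filter] at hz ⊢
      exact ⟨(hf z hz.1).1, hz.2⟩
    · intro z hz
      rw [Finset.mem_coe, Finset.mem_filter] at hz ⊢
      rw [(hf z hz.1).2]
      exact ⟨(hf z hz.1).1, hz.2⟩
    · intro z hz
      exact (hf z (Finset.mem_filter.mp hz).1).2
    · intro z hz
      exact (hf z (Finset.mem_filter.mp hz).1).2
  have k₀ := corner h₀ (by linarith) (by linarith) id (fun z hz => ⟨hz, rfl⟩)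
  have k₁ := corner h₁ (by linarith) (by linarith) (fun z => (a - z.1, z.2))
    (fun z hz => by simp at hz ⊢; omega)
  have k₂ := corner h₂ (by linarith) (by linarith) (fun z => (a - z.1, b - z.2))
    (fun z hz => by simp at hz ⊢; omega)
  have k₃ := corner h₃ (by linarith) (by linarith) (fun z => (z.1, b - z.2))
    (fun z hz => by simp at hz ⊢; omega)
  have hsum : ((Finset.Icc 0 a ×ˢ Finset.Icc 0 b).card : ℤ) =
      ((Finset.Icc 0 a ×ˢ Finset.Icc 0 b).filter (fun z =>
        (c₀ ≤ z.1 + z.2 ∧ z.1 + z.2 ≤ a + b - c₂) ∧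
        (c₃ - b ≤ z.1 - z.2 ∧ z.1 - z.2 ≤ a - c₁))).card +
      ((Finset.Icc 0 a ×ˢ Finset.Icc 0 b).filter (fun z => z.1 + z.2 < c₀)).card +
      ((Finset.Icc 0 a ×ˢ Finset.Icc 0 b).filter (fun z => a - z.1 + z.2 < c₁)).card +
      ((Finset.Icc 0 a ×ˢ Finset.Icc 0 b).filter (fun z => a - z.1 + (b - z.2) < c₂)).card +
      ((Finset.Icc 0 a ×ˢ Finset.Icc 0 b).filter (fun z => z.1 + (b - z.2) < c₃)).card := by
    -- Compared pointwise: the non-overlap hypotheses put each point of the box in exactly one of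
    -- the five sets.
    rw [Finset.card_eq_sum_ones]
    simp only [Finset.card_filter]
    push_cast
    simp only [← Finset.sum_add_distrib]
    refine Finset.sum_congr rfl fun z hz => ?_
    simp only [Finset.mem_product, Finset.mem_Icc] at hz
    split_ifs <;> omega
  simp only [id] at k₀
  linarith

/-! ### The octagon around an anticode -/

theorem IsTristanceAnticode.finite {d : ℕ} {A : Set (ℤ × ℤ)}
    (hA : IsTristanceAnticode infinityGraph d A) : A.Finite := by
  rw [isTristanceAnticode_infinityGraph_iff] at hA
  rcases A.eq_empty_or_nonempty with rfl | ⟨p, hp⟩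
  · exact Set.finite_empty
  refine (Set.finite_Icc (p.1 - 2 * d, p.2 - 2 * d) (p.1 + 2 * d, p.2 + 2 * d)).subset ?_
  intro q hq
  have h := hA p hp q hq q hq
  have h1 := le_abs_self ((p.1 + p.2) - (q.1 + q.2))
  have h2 := neg_abs_le ((p.1 + p.2) - (q.1 + q.2))
  have h3 := le_abs_self ((p.1 - p.2) - (q.1 - q.2))
  have h4 := neg_abs_le ((p.1 - p.2) - (q.1 - q.2))
  rw [Set.mem_Icc, Prod.le_def, Prod.le_def]
  simp only
  omega

/-- A nonempty anticode lies in an octagon all of whose sides touch it. -/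
theorem IsTristanceAnticode.exists_octagon {d : ℕ} {A : Set (ℤ × ℤ)}
    (hA : IsTristanceAnticode infinityGraph d A) (hne : A.Nonempty) :
    ∃ (v : ℤ × ℤ) (a b c₀ c₁ c₂ c₃ : ℤ), A ⊆ (fun z => v + z) '' octagon a b c₀ c₁ c₂ c₃ ∧
      0 ≤ a ∧ 0 ≤ b ∧ (0 ≤ c₀ ∧ 0 ≤ c₁ ∧ 0 ≤ c₂ ∧ 0 ≤ c₃) ∧
      (c₀ + c₁ ≤ a ∧ c₁ + c₂ ≤ b ∧ c₂ + c₃ ≤ a ∧ c₀ + c₃ ≤ b) ∧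
      2 * a + b - 2 * d ≤ c₀ + c₃ ∧ 2 * a + b - 2 * d ≤ c₁ + c₂ ∧
      a + 2 * b - 2 * d ≤ c₀ + c₁ ∧ a + 2 * b - 2 * d ≤ c₂ + c₃ := by
  have hfin := hA.finite
  rw [isTristanceAnticode_infinityGraph_iff] at hA
  obtain ⟨l, hl, hl'⟩ := A.exists_min_image (fun z => z.1) hfin hne
  obtain ⟨r, hr, hr'⟩ := A.exists_max_image (fun z => z.1) hfin hne
  obtain ⟨s, hs, hs'⟩ := A.exists_min_image (fun z => z.2) hfin hne
  obtain ⟨t, ht, ht'⟩ := A.exists_max_image (fun z => z.2) hfin hne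
  obtain ⟨u, hu, hu'⟩ := A.exists_min_image (fun z => z.1 + z.2) hfin hne
  obtain ⟨U, hU, hU'⟩ := A.exists_max_image (fun z => z.1 + z.2) hfin hne
  obtain ⟨v, hv, hv'⟩ := A.exists_min_image (fun z => z.1 - z.2) hfin hne
  obtain ⟨V, hV, hV'⟩ := A.exists_max_image (fun z => z.1 - z.2) hfin hne
  refine ⟨(l.1, s.2), r.1 - l.1, t.2 - s.2, u.1 + u.2 - l.1 - s.2, r.1 - s.2 - (V.1 - V.2),
    r.1 + t.2 - (U.1 + U.2), v.1 - v.2 + t.2 - l.1, ?_, ?_⟩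
  · intro z hz
    have := hl' z hz
    have := hr' z hz
    have := hs' z hz
    have := ht' z hz
    have := hu' z hz
    have := hU' z hz
    have := hv' z hz
    have := hV' z hz
    refine ⟨(z.1 - l.1, z.2 - s.2), ?_, by ext <;> simp⟩
    simp only [octagon, Set.mem_ofPred_eq]
    omega
  -- The common point is extremal in `x` or `y`. For `r`, for instance, `u + v = 2 * x` is twice the
  -- right side, and the minima of `u` and `v` bring in `c₀` and `c₃`.
  · have e1 := hA r hr u hu v hv
    have e2 := hA l hl U hU V hV
    have e3 := hA t ht u hu V hV
    have e4 := hA s hs U hU v hv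
    have f1 := (add_le_add (le_abs_self _) (le_abs_self _)).trans e1
    have f2 := (add_le_add (neg_le_abs _) (neg_le_abs _)).trans e2
    have f3 := (add_le_add (le_abs_self _) (neg_le_abs _)).trans e3
    have f4 := (add_le_add (neg_le_abs _) (le_abs_self _)).trans e4
    clear e1 e2 e3 e4 hA
    have g1 := hl' r hr
    have g2 := hs' t ht
    have g3 := hl' u hu
    have g4 := hs' u hu
    have g5 := hr' V hV
    have g6 := hs' V hV
    have g7 := hr' U hU
    have g8 := ht' U hU
    have g9 := hl' v hv
    have g10 := ht' v hv
    have i1 := hu' s hs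
    have i2 := hV' s hs
    have i3 := hu' l hl
    have i4 := hv' l hl
    have i5 := hU' r hr
    have i6 := hV' r hr
    have i7 := hU' t ht
    have i8 := hv' t ht
    clear hl' hr' hs' ht' hu' hU' hv' hV'
    refine ⟨?_, ?_, ⟨?_, ?_, ?_, ?_⟩, ⟨?_, ?_, ?_, ?_⟩, ?_, ?_, ?_, ?_⟩ <;> linarith

/-! ### Optimizing the parameters -/

/-- The four constraints add up to `3 * (a + b) - 4 * d ≤ ∑ cᵢ`. Multiplying this by `a + b + 2` and
completing squares bounds the count by a concave quadratic in `a + b` and `a - b`; `hF` says that it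
is close to its maximum. The squared differences of the `cᵢ` replace them by their mean. -/
theorem octagon_param_bound {d a b c₀ c₁ c₂ c₃ : ℤ} (ha : 0 ≤ a) (hb : 0 ≤ b)
    (h₁ : 2 * a + b - 2 * d ≤ c₀ + c₃) (h₂ : 2 * a + b - 2 * d ≤ c₁ + c₂)
    (h₃ : a + 2 * b - 2 * d ≤ c₀ + c₁) (h₄ : a + 2 * b - 2 * d ≤ c₂ + c₃)
    (hF : (4 * (d + 1) ^ 2 - 2) * 2 ≤ 7 * (2 * ((a + 1) * (b + 1))
      - (c₀ * (c₀ + 1) + c₁ * (c₁ + 1) + c₂ * (c₂ + 1) + c₃ * (c₃ + 1)))) :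
    (7 * (a + b + 2) - 12 * (d + 1)) ^ 2 + 63 * (a - b) ^ 2 ≤ 198 := by
  have e : 0 ≤ (a + b + 2) * (c₀ + c₁ + c₂ + c₃ - 3 * (a + b) + 4 * d) :=
    mul_nonneg (by linarith) (by linarith)
  nlinarith [sq_nonneg (3 * (c₀ + c₁ + c₂ + c₃ + 2) - 2 * (a + b + 2)),
    sq_nonneg (c₀ - c₁), sq_nonneg (c₀ - c₂), sq_nonneg (c₀ - c₃), sq_nonneg (c₁ - c₂),
    sq_nonneg (c₁ - c₃), sq_nonneg (c₂ - c₃)]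

/-- No integer lies strictly between `k` and `k + 1`. This supplies linear lower bounds for `x * (x
+ 1)`, sharp at two consecutive integers. -/
theorem tangent_nonneg (x k : ℤ) : 0 ≤ (x - k) * (x - k - 1) := by
  rcases le_or_gt x k with h | h
  · exact mul_nonneg_of_nonpos_of_nonpos (by linarith) (by linarith)
  · exact mul_nonneg (by linarith) (by linarith [Int.add_one_le_iff.mpr h])

/-- The triples `(r, α, β)` that satisfy `octagon_param_bound`. -/
def sideOffsets : List (ℤ × ℤ × ℤ) :=
  [(0, -1, -1), (0, -1, 0), (0, 0, -1), (0, 0, 0), (0, 0, 1), (0, 1, 0), (1, 0, 0), (1, 0, 1), (1, 1, 0), (1, 1, 1), (1, 1, 2), (1, 2, 1), (2, 1, 1), (2, 1, 2), (2, 2, 1), (2, 2, 2), (3, 2, 2), (3, 2, 3), (3, 3, 2), (3, 3, 3), (4, 2, 3), (4, 3, 2), (4, 3, 3), (4, 3, 4), (4, 4, 3), (4, 4, 4), (5, 3, 4), (5, 4, 3), (5, 4, 4), (5, 4, 5), (5, 5, 4), (5, 5, 5), (6, 4, 4), (6, 4, 5), (6, 5, 4), (6, 5, 5), (6, 5, 6),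 (6, 6, 5), (6, 6, 6)]

theorem mem_sideOffsets {r α β : ℤ} (hr : 0 ≤ r) (hr' : r ≤ 6)
    (hb : (7 * (α + β + 2) - 12 * (r + 1)) ^ 2 + 63 * (α - β) ^ 2 ≤ 198) :
    (r, α, β) ∈ sideOffsets := by
  have hd : α - β ≤ 1 := by nlinarith [sq_nonneg (7 * (α + β + 2) - 12 * (r + 1))]
  have hd' : -1 ≤ α - β := by nlinarith [sq_nonneg (7 * (α + β + 2) - 12 * (r + 1))]
  have hs : 7 * (α + β + 2) - 12 * (r + 1) ≤ 14 := by nlinarith [sq_nonneg (α - β)]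
  have hs' : -14 ≤ 7 * (α + β + 2) - 12 * (r + 1) := by nlinarith [sq_nonneg (α - β)]
  have hα : -1 ≤ α := by omega
  have hα' : α ≤ 6 := by omega
  obtain ⟨δ, rfl⟩ : ∃ δ, β = α - δ := ⟨α - β, by ring⟩
  rw [sub_sub_cancel] at *
  interval_cases r <;> interval_cases α <;> interval_cases δ <;>
    first | (exfalso; revert hb; norm_num; done) | decide

/-- The tangent inequality sharp at `q - 1` and `q`, summed over the corners, already attains the
bound in `hF`. So every `gᵢ` is one of these two, and the pair sums exclude `q - 1`. -/
theorem square_corners {q g₀ g₁ g₂ g₃ X : ℤ} (hq : 0 ≤ q) (hX : X ≤ 0)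
    (h₁ : 2 * q ≤ g₀ + g₃) (h₂ : 2 * q ≤ g₁ + g₂)
    (hF : g₀ * (g₀ + 1) + g₁ * (g₁ + 1) + g₂ * (g₂ + 1) + g₃ * (g₃ + 1)
      ≤ 4 * (q * (q + 1)) + 4 * X) :
    X = 0 ∧ g₀ = q ∧ g₁ = q ∧ g₂ = q ∧ g₃ = q := by
  have e : 0 ≤ q * (g₀ + g₁ + g₂ + g₃ - 4 * q) := mul_nonneg hq (by linarith)
  have t (x : ℤ) : 0 ≤ (x - q) * (x - q + 1) := by
    have := tangent_nonneg x (q - 1)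
    ring_nf at this ⊢
    exact this
  have t₀ := t g₀
  have t₁ := t g₁
  have t₂ := t g₂
  have t₃ := t g₃
  have z (x : ℤ) (hx : (x - q) * (x - q + 1) ≤ 0) : x = q ∨ x = q - 1 := by
    rcases mul_eq_zero.mp (le_antisymm hx (t x)) with h | h <;> omega
  have z₀ := z g₀ (by linarith)
  have z₁ := z g₁ (by linarith)
  have z₂ := z g₂ (by linarith)
  have z₃ := z g₃ (by linarith)
  have hX' : 0 ≤ X := by linarith
  omega

/-- As in `square_corners`, with the tangent sharp at `q` and `q + 1`. Equality also forces the
adjacent sums to be `2 * q + 1`, so the two values alternate around the octagon. -/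
theorem alternating_corners {q g₀ g₁ g₂ g₃ X : ℤ} (hq : 0 ≤ q) (hX : X ≤ 0)
    (h₁ : 2 * q + 1 ≤ g₀ + g₃) (h₂ : 2 * q + 1 ≤ g₁ + g₂) (h₃ : 2 * q + 1 ≤ g₀ + g₁)
    (h₄ : 2 * q + 1 ≤ g₂ + g₃)
    (hF : g₀ * (g₀ + 1) + g₁ * (g₁ + 1) + g₂ * (g₂ + 1) + g₃ * (g₃ + 1)
      ≤ 4 * (q + 1) ^ 2 + 4 * X) :
    X = 0 ∧ g₀ = g₂ ∧ g₁ = g₃ ∧ (g₀ = q ∧ g₁ = q + 1 ∨ g₀ = q + 1 ∧ g₁ = q) := by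
  have e : 0 ≤ (q + 1) * (g₀ + g₁ + g₂ + g₃ - 4 * q - 2) := mul_nonneg (by linarith) (by linarith)
  have t₀ := tangent_nonneg g₀ q
  have t₁ := tangent_nonneg g₁ q
  have t₂ := tangent_nonneg g₂ q
  have t₃ := tangent_nonneg g₃ q
  have z (x : ℤ) (hx : (x - q) * (x - q - 1) ≤ 0) : x = q ∨ x = q + 1 := by
    rcases mul_eq_zero.mp (le_antisymm hx (tangent_nonneg x q)) with h | h <;> omega
  have z₀ := z g₀ (by linarith)
  have z₁ := z g₁ (by linarith)
  have z₂ := z g₂ (by linarith)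
  have z₃ := z g₃ (by linarith)
  have hX' : 0 ≤ X := by linarith
  have hs : g₀ + g₁ + g₂ + g₃ - 4 * q - 2 ≤ 0 := by
    by_contra hcon
    have := mul_pos (show 0 < q + 1 by linarith) (not_le.mp hcon)
    linarith
  omega

/-- Treats sides with `α ≠ β`, where only one pair of opposite constraints is needed; it isolates
the exceptional segment for `d = 1`. -/
theorem no_corners {g₀ g₁ g₂ g₃ X : ℤ} (hX : X ≤ 0)
    (h : 0 ≤ g₀ + g₃ ∧ 0 ≤ g₁ + g₂ ∨ 0 ≤ g₀ + g₁ ∧ 0 ≤ g₂ + g₃)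
    (hF : g₀ * (g₀ + 1) + g₁ * (g₁ + 1) + g₂ * (g₂ + 1) + g₃ * (g₃ + 1) ≤ 4 * X) :
    X = 0 ∧ g₀ = 0 ∧ g₁ = 0 ∧ g₂ = 0 ∧ g₃ = 0 := by
  have t (x : ℤ) : 0 ≤ x * (x + 1) := by linarith [tangent_nonneg x (-1)]
  have t₀ := t g₀
  have t₁ := t g₁
  have t₂ := t g₂
  have t₃ := t g₃
  have z (x : ℤ) (hx : x * (x + 1) ≤ 0) : x = 0 ∨ x = -1 := by
    rcases mul_eq_zero.mp (le_antisymm hx (t x)) with h | h <;> omega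
  have z₀ := z g₀ (by linarith)
  have z₁ := z g₁ (by linarith)
  have z₂ := z g₂ (by linarith)
  have z₃ := z g₃ (by linarith)
  have hX' : 0 ≤ X := by linarith
  omega

-- A finite check over `sideOffsets`: most triples are refuted linearly by the tangent inequalities,
-- the others fix the corners. The slack of the summed constraints enters multiplied by `n`, so the
-- segment, whose slack is nonzero, survives only for `n = 0`.
set_option maxHeartbeats 1000000 in
theorem octagon_param_opt {n r α β g₀ g₁ g₂ g₃ : ℤ} (hn : 0 ≤ n) (hr : 0 ≤ r) (hr' : r ≤ 6)
    (h₁ : 2 * α + β - 2 * r ≤ g₀ + g₃) (h₂ : 2 * α + β - 2 * r ≤ g₁ + g₂)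
    (h₃ : α + 2 * β - 2 * r ≤ g₀ + g₁) (h₄ : α + 2 * β - 2 * r ≤ g₂ + g₃)
    (hF : (4 * (r + 1) ^ 2 + 4) / 7 * 2 ≤ 4 * (n * (3 * (α + β) - 4 * r - (g₀ + g₁ + g₂ + g₃)))
      + 2 * ((α + 1) * (β + 1))
      - (g₀ * (g₀ + 1) + g₁ * (g₁ + 1) + g₂ * (g₂ + 1) + g₃ * (g₃ + 1)))
    (hb : (7 * (α + β + 2) - 12 * (r + 1)) ^ 2 + 63 * (α - β) ^ 2 ≤ 198) :
    (4 * (r + 1) ^ 2 + 4) / 7 * 2 = 4 * (n * (3 * (α + β) - 4 * r - (g₀ + g₁ + g₂ + g₃)))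
      + 2 * ((α + 1) * (β + 1))
      - (g₀ * (g₀ + 1) + g₁ * (g₁ + 1) + g₂ * (g₂ + 1) + g₃ * (g₃ + 1)) ∧
    ((g₀ = g₂ ∧ g₁ = g₃ ∧ α = β ∧ (r, α, g₀, g₁) ∈ ([(0, 0, 0, 0), (1, 1, 0, 1), (1, 1, 1, 0),
      (2, 2, 1, 1), (3, 2, 0, 0), (4, 3, 0, 1), (4, 3, 1, 0), (5, 4, 1, 1), (6, 5, 1, 2),
      (6, 5, 2, 1)] : List (ℤ × ℤ × ℤ × ℤ))) ∨
      (n = 0 ∧ r = 1 ∧ g₀ = 0 ∧ g₁ = 0 ∧ g₂ = 0 ∧ g₃ = 0 ∧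
        ((α = 1 ∧ β = 0) ∨ (α = 0 ∧ β = 1)))) := by
  have hT := mem_sideOffsets hr hr' hb
  clear hb
  have hN : n * (3 * (α + β) - 4 * r - (g₀ + g₁ + g₂ + g₃)) ≤ 0 :=
    mul_nonpos_of_nonneg_of_nonpos hn (by linarith)
  -- Keeps what the cases need about the product once it is replaced by a variable `X`: the slack
  -- factor is nonpositive, so `1 ≤ n` can only lower it.
  have hN' : n = 0 ∨ n * (3 * (α + β) - 4 * r - (g₀ + g₁ + g₂ + g₃)) ≤
      (3 * (α + β) - 4 * r - (g₀ + g₁ + g₂ + g₃)) := by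
    rcases hn.eq_or_lt with h | h
    · exact Or.inl h.symm
    · right; nlinarith
  have t (x : ℤ) : 0 ≤ x * (x + 1) + 2 * x + 2 ∧ 0 ≤ x * (x + 1) ∧ 0 ≤ x * (x + 1) - 2 * x ∧
      0 ≤ x * (x + 1) - 4 * x + 2 ∧ 0 ≤ x * (x + 1) - 6 * x + 6 :=
    ⟨by linarith [tangent_nonneg x (-2)], by linarith [tangent_nonneg x (-1)],
      by linarith [tangent_nonneg x 0], by linarith [tangent_nonneg x 1],
      by linarith [tangent_nonneg x 2]⟩
  have t₀ := t g₀
  have t₁ := t g₁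
  have t₂ := t g₂
  have t₃ := t g₃
  clear t
  generalize n * (3 * (α + β) - 4 * r - (g₀ + g₁ + g₂ + g₃)) = X at *
  simp only [sideOffsets, List.mem_cons, Prod.mk.injEq, List.not_mem_nil, or_false] at hT ⊢
  rcases hT with ⟨rfl, rfl, rfl⟩ | ⟨rfl, rfl, rfl⟩ | ⟨rfl, rfl, rfl⟩ | ⟨rfl, rfl, rfl⟩ | ⟨rfl, rfl, rfl⟩
    | ⟨rfl, rfl, rfl⟩ | ⟨rfl, rfl, rfl⟩ | ⟨rfl, rfl, rfl⟩ | ⟨rfl, rfl, rfl⟩ | ⟨rfl, rfl, rfl⟩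
    | ⟨rfl, rfl, rfl⟩ | ⟨rfl, rfl, rfl⟩ | ⟨rfl, rfl, rfl⟩ | ⟨rfl, rfl, rfl⟩ | ⟨rfl, rfl, rfl⟩
    | ⟨rfl, rfl, rfl⟩ | ⟨rfl, rfl, rfl⟩ | ⟨rfl, rfl, rfl⟩ | ⟨rfl, rfl, rfl⟩ | ⟨rfl, rfl, rfl⟩
    | ⟨rfl, rfl, rfl⟩ | ⟨rfl, rfl, rfl⟩ | ⟨rfl, rfl, rfl⟩ | ⟨rfl, rfl, rfl⟩ | ⟨rfl, rfl, rfl⟩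
    | ⟨rfl, rfl, rfl⟩ | ⟨rfl, rfl, rfl⟩ | ⟨rfl, rfl, rfl⟩ | ⟨rfl, rfl, rfl⟩ | ⟨rfl, rfl, rfl⟩
    | ⟨rfl, rfl, rfl⟩ | ⟨rfl, rfl, rfl⟩ | ⟨rfl, rfl, rfl⟩ | ⟨rfl, rfl, rfl⟩ | ⟨rfl, rfl, rfl⟩
    | ⟨rfl, rfl, rfl⟩ | ⟨rfl, rfl, rfl⟩ | ⟨rfl, rfl, rfl⟩ | ⟨rfl, rfl, rfl⟩
  all_goals norm_num at hF h₁ h₂ h₃ h₄ hN' ⊢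
  all_goals first
    | (exfalso; linarith [t₀.1, t₀.2.1, t₀.2.2.1, t₀.2.2.2.1, t₀.2.2.2.2, t₁.1, t₁.2.1, t₁.2.2.1,
        t₁.2.2.2.1, t₁.2.2.2.2, t₂.1, t₂.2.1, t₂.2.2.1, t₂.2.2.2.1, t₂.2.2.2.2, t₃.1, t₃.2.1,
        t₃.2.2.1, t₃.2.2.2.1, t₃.2.2.2.2])
    | (obtain ⟨rfl, rfl, rfl, rfl, rfl⟩ := square_corners (q := 0) (g₀ := g₀) (g₁ := g₁) (g₂ := g₂)
        (g₃ := g₃) le_rfl hN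
        (by linarith) (by linarith) (by linarith)
       norm_num; done)
    | (obtain ⟨rfl, rfl, rfl, rfl, rfl⟩ := square_corners (q := 1) (g₀ := g₀) (g₁ := g₁) (g₂ := g₂)
        (g₃ := g₃) zero_le_one hN
        (by linarith) (by linarith) (by linarith)
       norm_num; done)
    | (obtain ⟨rfl, rfl, rfl, ⟨rfl, rfl⟩ | ⟨rfl, rfl⟩⟩ := alternating_corners (q := 0)
        (g₀ := g₀) (g₁ := g₁) (g₂ := g₂) (g₃ := g₃) le_rfl hN
        (by linarith) (by linarith) (by linarith) (by linarith) (by linarith) <;>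
       norm_num; done)
    | (obtain ⟨rfl, rfl, rfl, ⟨rfl, rfl⟩ | ⟨rfl, rfl⟩⟩ := alternating_corners (q := 1)
        (g₀ := g₀) (g₁ := g₁) (g₂ := g₂) (g₃ := g₃) zero_le_one hN
        (by linarith) (by linarith) (by linarith) (by linarith) (by linarith) <;>
       norm_num; done)
    | (obtain ⟨rfl, rfl, rfl, rfl, rfl⟩ := no_corners hN (.inl ⟨h₁, h₂⟩) (by linarith)
       norm_num at *; omega)
    | (obtain ⟨rfl, rfl, rfl, rfl, rfl⟩ := no_corners hN (.inr ⟨h₃, h₄⟩) (by linarith)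
       norm_num at *; omega)

/-! ### Closed forms for the size and the table -/

/-- The number of points of an optimal anticode of diameter `d`. -/
def optimalSize (d : ℕ) : ℤ := (4 * ((d : ℤ) + 1) ^ 2 + 4) / 7

theorem optimalSize_pos (d : ℕ) : 0 < optimalSize d := by
  have : (0 : ℤ) ≤ d := Int.natCast_nonneg d
  unfold optimalSize
  have : 7 ≤ 4 * ((d : ℤ) + 1) ^ 2 + 4 := by nlinarith
  omega

theorem optimalSize_eq (d : ℕ) : optimalSize d =
    28 * (d / 7 : ℤ) ^ 2 + 8 * ((d / 7 : ℤ) * (d % 7 + 1)) + (4 * ((d % 7 : ℤ) + 1) ^ 2 + 4) / 7 := by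
  unfold optimalSize
  have h : (d : ℤ) = 7 * (d / 7 : ℤ) + d % 7 := by omega
  set n := (d / 7 : ℤ)
  set r := (d % 7 : ℤ)
  rw [h, show 4 * (7 * n + r + 1) ^ 2 + 4 =
    (4 * (r + 1) ^ 2 + 4) + 7 * (28 * n ^ 2 + 8 * (n * (r + 1))) by ring,
    Int.add_mul_ediv_left _ _ (by norm_num)]
  ring

theorem params_eq (d : ℕ) : ((d % 7 : ℤ), paramA d - 6 * (d / 7 : ℤ), paramC d - 2 * (d / 7 : ℤ),
    paramC' d - 2 * (d / 7 : ℤ)) ∈ ([(0, 0, 0, 0), (1, 1, 0, 1), (2, 2, 1, 1), (3, 2, 0, 0),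
      (4, 3, 0, 1), (5, 4, 1, 1), (6, 5, 1, 2)] : List (ℤ × ℤ × ℤ × ℤ)) := by
  obtain h | h | h | h | h | h | h : d % 7 = 0 ∨ d % 7 = 1 ∨ d % 7 = 2 ∨ d % 7 = 3 ∨ d % 7 = 4 ∨
      d % 7 = 5 ∨ d % 7 = 6 := by omega
  · rw [show (d % 7 : ℤ) = 0 by omega,
      show paramA d - 6 * (d / 7 : ℤ) = 0 by simp only [paramA, h]; omega,
      show paramC d - 2 * (d / 7 : ℤ) = 0 by simp only [paramC, h]; omega,
      show paramC' d - 2 * (d / 7 : ℤ) = 0 by simp only [paramC', h]; omega]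
    simp
  · rw [show (d % 7 : ℤ) = 1 by omega,
      show paramA d - 6 * (d / 7 : ℤ) = 1 by simp only [paramA, h]; omega,
      show paramC d - 2 * (d / 7 : ℤ) = 0 by simp only [paramC, h]; omega,
      show paramC' d - 2 * (d / 7 : ℤ) = 1 by simp only [paramC', h]; omega]
    simp
  · rw [show (d % 7 : ℤ) = 2 by omega,
      show paramA d - 6 * (d / 7 : ℤ) = 2 by simp only [paramA, h]; omega,
      show paramC d - 2 * (d / 7 : ℤ) = 1 by simp only [paramC, h]; omega,
      show paramC' d - 2 * (d / 7 : ℤ) = 1 by simp only [paramC', h]; omega]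
    simp
  · rw [show (d % 7 : ℤ) = 3 by omega,
      show paramA d - 6 * (d / 7 : ℤ) = 2 by simp only [paramA, h]; omega,
      show paramC d - 2 * (d / 7 : ℤ) = 0 by simp only [paramC, h]; omega,
      show paramC' d - 2 * (d / 7 : ℤ) = 0 by simp only [paramC', h]; omega]
    simp
  · rw [show (d % 7 : ℤ) = 4 by omega,
      show paramA d - 6 * (d / 7 : ℤ) = 3 by simp only [paramA, h]; omega,
      show paramC d - 2 * (d / 7 : ℤ) = 0 by simp only [paramC, h]; omega,
      show paramC' d - 2 * (d / 7 : ℤ) = 1 by simp only [paramC', h]; omega]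
    simp
  · rw [show (d % 7 : ℤ) = 5 by omega,
      show paramA d - 6 * (d / 7 : ℤ) = 4 by simp only [paramA, h]; omega,
      show paramC d - 2 * (d / 7 : ℤ) = 1 by simp only [paramC, h]; omega,
      show paramC' d - 2 * (d / 7 : ℤ) = 1 by simp only [paramC', h]; omega]
    simp
  · rw [show (d % 7 : ℤ) = 6 by omega,
      show paramA d - 6 * (d / 7 : ℤ) = 5 by simp only [paramA, h]; omega,
      show paramC d - 2 * (d / 7 : ℤ) = 1 by simp only [paramC, h]; omega,
      show paramC' d - 2 * (d / 7 : ℤ) = 2 by simp only [paramC', h]; omega]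
    simp

theorem optimalSize_eq_ceil (d : ℕ) :
    optimalSize d = ⌈(4 * (d : ℚ) ^ 2 + 8 * (d : ℚ) + 2) / 7⌉ := by
  symm
  rw [Int.ceil_eq_iff, lt_div_iff₀ (by norm_num), div_le_iff₀ (by norm_num)]
  -- The ceiling of `m / 7` is the floor of `(m + 6) / 7`, here with `m = 4 * (d + 1) ^ 2 - 2`.
  have h1 : optimalSize d * 7 ≤ 4 * ((d : ℤ) + 1) ^ 2 + 4 := by unfold optimalSize; omega
  have h2 : 4 * ((d : ℤ) + 1) ^ 2 + 4 ≤ optimalSize d * 7 + 6 := by unfold optimalSize; omega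
  have h1' : (optimalSize d : ℚ) * 7 ≤ 4 * ((d : ℚ) + 1) ^ 2 + 4 := by exact_mod_cast h1
  have h2' : 4 * ((d : ℚ) + 1) ^ 2 + 4 ≤ (optimalSize d : ℚ) * 7 + 6 := by exact_mod_cast h2
  constructor <;> linarith

theorem optimalSize_eq_tableSize (d : ℕ) : (optimalSize d : ℚ) = tableSize d := by
  rw [optimalSize_eq]
  have hq : (d : ℚ) = 7 * ((d / 7 : ℤ) : ℚ) + ((d % 7 : ℤ) : ℚ) := by
    exact_mod_cast (Int.mul_ediv_add_emod d 7).symm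
  obtain h | h | h | h | h | h | h : d % 7 = 0 ∨ d % 7 = 1 ∨ d % 7 = 2 ∨ d % 7 = 3 ∨ d % 7 = 4 ∨
      d % 7 = 5 ∨ d % 7 = 6 := by omega
  · rw [show (d % 7 : ℤ) = 0 by omega] at hq ⊢
    norm_num [tableSize, h, hq]
    ring
  · rw [show (d % 7 : ℤ) = 1 by omega] at hq ⊢
    norm_num [tableSize, h, hq]
    ring
  · rw [show (d % 7 : ℤ) = 2 by omega] at hq ⊢
    norm_num [tableSize, h, hq]
    ring
  · rw [show (d % 7 : ℤ) = 3 by omega] at hq ⊢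
    norm_num [tableSize, h, hq]
    ring
  · rw [show (d % 7 : ℤ) = 4 by omega] at hq ⊢
    norm_num [tableSize, h, hq]
    ring
  · rw [show (d % 7 : ℤ) = 5 by omega] at hq ⊢
    norm_num [tableSize, h, hq]
    ring
  · rw [show (d % 7 : ℤ) = 6 by omega] at hq ⊢
    norm_num [tableSize, h, hq]
    ring

/-! ### Octagons as anticodes, and symmetries -/

/-- For each choice of signs, `±u p ± v p` is twice a coordinate of `p` up to sign, hence bounded by
a side; `u q` and `v r` are bounded by two neighbouring cuts, as in one of the hypotheses. -/
theorem octagon_isTristanceAnticode {d : ℕ} {a b c₀ c₁ c₂ c₃ : ℤ}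
    (h₁ : 2 * a + b - 2 * d ≤ c₀ + c₃) (h₂ : 2 * a + b - 2 * d ≤ c₁ + c₂)
    (h₃ : a + 2 * b - 2 * d ≤ c₀ + c₁) (h₄ : a + 2 * b - 2 * d ≤ c₂ + c₃) :
    IsTristanceAnticode infinityGraph d (octagon a b c₀ c₁ c₂ c₃) := by
  rw [isTristanceAnticode_infinityGraph_iff]
  intro p hp q hq r hr
  simp only [octagon, Set.mem_ofPred_eq] at hp hq hr
  rcases abs_cases ((p.1 + p.2) - (q.1 + q.2)) with h | h <;>
    rcases abs_cases ((p.1 - p.2) - (r.1 - r.2)) with h' | h' <;> rw [h.1, h'.1] <;> omega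

theorem IsTristanceAnticode.image_translate {d : ℕ} {A : Set (ℤ × ℤ)}
    (hA : IsTristanceAnticode infinityGraph d A) (v : ℤ × ℤ) :
    IsTristanceAnticode infinityGraph d ((fun z => v + z) '' A) := by
  rw [isTristanceAnticode_infinityGraph_iff] at *
  rintro _ ⟨p, hp, rfl⟩ _ ⟨q, hq, rfl⟩ _ ⟨r, hr, rfl⟩
  convert hA p hp q hq r hr using 3 <;> simp only [Prod.fst_add, Prod.snd_add] <;> ring

theorem IsTristanceAnticode.image_quarterTurn {d : ℕ} {A : Set (ℤ × ℤ)}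
    (hA : IsTristanceAnticode infinityGraph d A) :
    IsTristanceAnticode infinityGraph d (quarterTurn '' A) := by
  rw [isTristanceAnticode_infinityGraph_iff] at *
  rintro _ ⟨p, hp, rfl⟩ _ ⟨q, hq, rfl⟩ _ ⟨r, hr, rfl⟩
  -- The rotation sends `(u, v)` to `(v, -u)`, so `q` and `r` change roles.
  refine le_of_eq_of_le ?_ (hA p hp r hr q hq)
  rw [add_comm, ← abs_neg (p.1 + p.2 - _)]
  congr 2 <;> simp only [quarterTurn] <;> ring

theorem IsTristanceAnticode.image_iterate_quarterTurn {d : ℕ} {A : Set (ℤ × ℤ)}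
    (hA : IsTristanceAnticode infinityGraph d A) (k : ℕ) :
    IsTristanceAnticode infinityGraph d (quarterTurn^[k] '' A) := by
  induction k with
  | zero => simpa using hA
  | succ k ih =>
    rw [Function.iterate_succ', Set.image_comp]
    exact ih.image_quarterTurn

theorem quarterTurn_injective : Function.Injective quarterTurn := by
  rintro ⟨a, b⟩ ⟨c, e⟩ h
  simp only [quarterTurn, Prod.mk.injEq] at h
  ext <;> simp only <;> omega

theorem EqUpToRotationTranslation.isTristanceAnticode {d : ℕ} {A B : Set (ℤ × ℤ)}
    (h : EqUpToRotationTranslation A B) (hB : IsTristanceAnticode infinityGraph d B) :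
    IsTristanceAnticode infinityGraph d A := by
  obtain ⟨k, v, rfl⟩ := h
  have := (hB.image_iterate_quarterTurn k).image_translate v
  rwa [Set.image_image] at this

theorem EqUpToRotationTranslation.ncard_eq {A B : Set (ℤ × ℤ)}
    (h : EqUpToRotationTranslation A B) : A.ncard = B.ncard := by
  obtain ⟨k, v, rfl⟩ := h
  exact Set.ncard_image_of_injective _
    ((add_right_injective v).comp (quarterTurn_injective.iterate k))

theorem eqUpToRotationTranslation_octagon_rotate (v : ℤ × ℤ) (a b c₀ c₁ c₂ c₃ : ℤ) :
    EqUpToRotationTranslation ((fun z => v + z) '' octagon b a c₃ c₀ c₁ c₂)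
      (octagon a b c₀ c₁ c₂ c₃) := by
  refine ⟨1, v + (b, 0), ?_⟩
  ext z
  simp only [Set.mem_image, Function.iterate_one]
  constructor
  · rintro ⟨w, hw, rfl⟩
    refine ⟨(w.2, b - w.1), ?_, ?_⟩
    · simp only [octagon, Set.mem_ofPred_eq] at hw ⊢
      omega
    · ext <;> simp [quarterTurn]
  · rintro ⟨w, hw, rfl⟩
    refine ⟨(b - w.2, w.1), ?_, ?_⟩
    · simp only [octagon, Set.mem_ofPred_eq] at hw ⊢
      omega
    · ext <;> (simp [quarterTurn]; try ring)

theorem eqUpToRotationTranslation_translate (v : ℤ × ℤ) (B : Set (ℤ × ℤ)) :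
    EqUpToRotationTranslation ((fun z => v + z) '' B) B := ⟨0, v, rfl⟩

/-! ### Optimality and uniqueness -/

theorem IsTristanceAnticode.eq_of_optimalSize_le {d : ℕ} {A : Set (ℤ × ℤ)}
    (hA : IsTristanceAnticode infinityGraph d A) (hc : optimalSize d ≤ A.ncard) :
    (A.ncard : ℤ) = optimalSize d ∧ (EqUpToRotationTranslation A (tableOctagon d) ∨
      (d = 1 ∧ EqUpToRotationTranslation A (octagon 1 0 0 0 0 0))) := by
  have hpos := optimalSize_pos d
  have hne : A.Nonempty := by
    rw [← Set.ncard_pos hA.finite]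
    omega
  obtain ⟨v, a, b, c₀, c₁, c₂, c₃, hsub, ha, hb, ⟨k₀, k₁, k₂, k₃⟩, ⟨l₀, l₁, l₂, l₃⟩, h₁, h₂, h₃,
    h₄⟩ := hA.exists_octagon hne
  have hfin : ((fun z => v + z) '' octagon a b c₀ c₁ c₂ c₃).Finite :=
    (octagon_finite _ _ _ _ _ _).image _
  have hle := Set.ncard_le_ncard hsub hfin
  have hO := two_mul_ncard_octagon k₀ k₁ k₂ k₃ l₀ l₁ l₂ l₃
  rw [← Set.ncard_image_of_injective _ (add_right_injective v)] at hO
  have h2 : 4 * ((d : ℤ) + 1) ^ 2 + 4 ≤ optimalSize d * 7 + 6 := by unfold optimalSize; omega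
  have hbd := octagon_param_bound ha hb h₁ h₂ h₃ h₄ (by omega)
  have hN := optimalSize_eq d
  have hp := params_eq d
  have hd : (d : ℤ) = 7 * (d / 7 : ℤ) + d % 7 := by omega
  have hn : 0 ≤ (d / 7 : ℤ) := by omega
  have hr : 0 ≤ (d % 7 : ℤ) := by omega
  have hr' : (d % 7 : ℤ) ≤ 6 := by omega
  generalize (d / 7 : ℤ) = n at *
  generalize (d % 7 : ℤ) = r at *
  obtain ⟨α, rfl⟩ : ∃ α, a = 6 * n + α := ⟨a - 6 * n, by ring⟩
  obtain ⟨β, rfl⟩ : ∃ α, b = 6 * n + α := ⟨b - 6 * n, by ring⟩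
  obtain ⟨g₀, rfl⟩ : ∃ α, c₀ = 2 * n + α := ⟨c₀ - 2 * n, by ring⟩
  obtain ⟨g₁, rfl⟩ : ∃ α, c₁ = 2 * n + α := ⟨c₁ - 2 * n, by ring⟩
  obtain ⟨g₂, rfl⟩ : ∃ α, c₂ = 2 * n + α := ⟨c₂ - 2 * n, by ring⟩
  obtain ⟨g₃, rfl⟩ : ∃ α, c₃ = 2 * n + α := ⟨c₃ - 2 * n, by ring⟩
  -- The `n`-dependent main term is that of `optimalSize_eq`; apart from the slack term, the rest
  -- depends only on the offsets.
  have hF : 2 * ((6 * n + α + 1) * (6 * n + β + 1)) -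
      ((2 * n + g₀) * (2 * n + g₀ + 1) + (2 * n + g₁) * (2 * n + g₁ + 1) +
        (2 * n + g₂) * (2 * n + g₂ + 1) + (2 * n + g₃) * (2 * n + g₃ + 1)) =
      2 * (28 * n ^ 2 + 8 * (n * (r + 1))) +
      (4 * (n * (3 * (α + β) - 4 * r - (g₀ + g₁ + g₂ + g₃)))
      + 2 * ((α + 1) * (β + 1))
      - (g₀ * (g₀ + 1) + g₁ * (g₁ + 1) + g₂ * (g₂ + 1) + g₃ * (g₃ + 1))) := by ring
  rw [hF] at hO
  have hbd' : (7 * (α + β + 2) - 12 * (r + 1)) ^ 2 + 63 * (α - β) ^ 2 ≤ 198 := by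
    rw [hd] at hbd
    ring_nf at hbd ⊢
    exact hbd
  obtain ⟨heq, hcase⟩ := octagon_param_opt (g₀ := g₀) (g₁ := g₁) (g₂ := g₂) (g₃ := g₃)
    hn hr hr' (by linarith) (by linarith) (by linarith)
    (by linarith) (by linarith) hbd'
  -- `A` lies in the octagon, whose size is exactly `optimalSize d`; so the two sets have equally
  -- many points and coincide.
  have hcard : A.ncard = ((fun z => v + z) ''
      octagon (6 * n + α) (6 * n + β) (2 * n + g₀) (2 * n + g₁) (2 * n + g₂) (2 * n + g₃)).ncard := by
    zify at hle ⊢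
    linarith
  refine ⟨by linarith, ?_⟩
  rw [Set.eq_of_subset_of_ncard_le hsub hcard.ge hfin]
  rcases hcase with ⟨rfl, rfl, rfl, hmem⟩ | ⟨rfl, rfl, rfl, rfl, rfl, rfl, h | h⟩
  · left
    have : (2 * n + g₀ = paramC d ∧ 2 * n + g₁ = paramC' d ∨
        2 * n + g₁ = paramC d ∧ 2 * n + g₀ = paramC' d) ∧ 6 * n + α = paramA d := by
      simp only [List.mem_cons, Prod.mk.injEq, List.not_mem_nil, or_false] at hmem hp
      omega
    obtain ⟨⟨e₀, e₁⟩ | ⟨e₀, e₁⟩, e⟩ := this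
    · rw [e₀, e₁, e]
      exact eqUpToRotationTranslation_translate _ _
    -- With the two cut sizes exchanged, the octagon is a quarter turn of the one in the table.
    · rw [e₀, e₁, e]
      exact eqUpToRotationTranslation_octagon_rotate _ _ _ _ _ _ _
  · obtain ⟨rfl, rfl⟩ := h
    exact .inr ⟨by omega, eqUpToRotationTranslation_translate _ _⟩
  · obtain ⟨rfl, rfl⟩ := h
    exact .inr ⟨by omega, eqUpToRotationTranslation_octagon_rotate _ _ _ _ _ _ _⟩

theorem isOptimalTristanceAnticode_of_ncard_eq {d : ℕ} {A : Set (ℤ × ℤ)}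
    (hA : IsTristanceAnticode infinityGraph d A) (hc : (A.ncard : ℤ) = optimalSize d) :
    IsOptimalTristanceAnticode infinityGraph d A := by
  refine ⟨hA, fun B hB => ?_⟩
  rw [← hA.finite.cast_ncard_eq, ← hB.finite.cast_ncard_eq]
  have : (B.ncard : ℤ) ≤ A.ncard := by
    rw [hc]
    by_contra h
    have := (hB.eq_of_optimalSize_le (not_le.mp h).le).1
    omega
  exact_mod_cast this

theorem tableOctagon_isTristanceAnticode (d : ℕ) :
    IsTristanceAnticode infinityGraph d (tableOctagon d) := by
  have hp := params_eq d
  simp only [List.mem_cons, Prod.mk.injEq, List.not_mem_nil, or_false] at hp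
  apply octagon_isTristanceAnticode <;> omega

theorem ncard_tableOctagon (d : ℕ) : ((tableOctagon d).ncard : ℤ) = optimalSize d := by
  have hp := params_eq d
  have hN := optimalSize_eq d
  simp only [List.mem_cons, Prod.mk.injEq, List.not_mem_nil, or_false] at hp
  have hO := two_mul_ncard_octagon (a := paramA d) (b := paramA d) (c₀ := paramC d)
    (c₁ := paramC' d) (c₂ := paramC d) (c₃ := paramC' d) (by omega) (by omega) (by omega)
    (by omega) (by omega) (by omega) (by omega) (by omega)
  rw [tableOctagon]
  obtain ⟨n, hn⟩ : ∃ n, n = (d / 7 : ℤ) := ⟨_, rfl⟩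
  rw [← hn] at hp hN
  rcases hp with h | h | h | h | h | h | h <;> obtain ⟨hr, ha, hc, hc'⟩ := h <;>
    rw [eq_add_of_sub_eq ha, eq_add_of_sub_eq hc, eq_add_of_sub_eq hc'] at hO ⊢ <;>
    rw [hr] at hN <;> norm_num at hN <;> linarith

theorem ncard_octagon_one_zero : ((octagon 1 0 0 0 0 0).ncard : ℤ) = optimalSize 1 := by
  have hO := two_mul_ncard_octagon (a := 1) (b := 0) (c₀ := 0) (c₁ := 0) (c₂ := 0) (c₃ := 0)
    le_rfl le_rfl le_rfl le_rfl (by norm_num) le_rfl (by norm_num) le_rfl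
  have : optimalSize 1 = 2 := by norm_num [optimalSize]
  omega

theorem mainTheorem2 (d : ℕ) :
    (∀ A : Set (ℤ × ℤ), IsOptimalTristanceAnticode infinityGraph d A →
      A.Finite ∧
      (A.ncard : ℤ) = ⌈(4 * (d : ℚ) ^ 2 + 8 * (d : ℚ) + 2) / 7⌉ ∧
      (A.ncard : ℚ) = tableSize d) ∧
    (∀ A : Set (ℤ × ℤ), IsOptimalTristanceAnticode infinityGraph d A ↔
      EqUpToRotationTranslation A (tableOctagon d) ∨
      (d = 1 ∧ EqUpToRotationTranslation A (octagon 1 0 0 0 0 0))) := by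
  have key (A : Set (ℤ × ℤ)) (hA : IsOptimalTristanceAnticode infinityGraph d A) :=
    hA.1.eq_of_optimalSize_le (by
      have h := hA.2 _ (tableOctagon_isTristanceAnticode d)
      rw [← hA.1.finite.cast_ncard_eq,
        ← (tableOctagon_isTristanceAnticode d).finite.cast_ncard_eq] at h
      rw [← ncard_tableOctagon]
      exact_mod_cast h)
  refine ⟨fun A hA => ⟨hA.1.finite, ?_, ?_⟩, fun A => ⟨fun hA => (key A hA).2, ?_⟩⟩
  · rw [← optimalSize_eq_ceil, (key A hA).1]
  · rw [← optimalSize_eq_tableSize, ← (key A hA).1]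
    norm_cast
  · rintro (h | ⟨rfl, h⟩)
    · refine isOptimalTristanceAnticode_of_ncard_eq
        (h.isTristanceAnticode (tableOctagon_isTristanceAnticode d)) ?_
      rw [h.ncard_eq, ncard_tableOctagon]
    · refine isOptimalTristanceAnticode_of_ncard_eq
        (h.isTristanceAnticode (octagon_isTristanceAnticode ?_ ?_ ?_ ?_)) ?_
      · norm_num
      · norm_num
      · norm_num
      · norm_num
      rw [h.ncard_eq, ncard_octagon_one_zero]
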